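/- **Conventions.** For a continuous map $f\colon X\to Y$ of topological spaces and an integer $N\ge 0$, $f$ is *$N$-connected* if $\pi_0(X)\to\pi_0(Y)$ is surjective and, for every basepoint $x\in X$, $\pi_k(X,x)\to\pi_k(Y,f(x))$ is bijective for $k<N$ and surjective for $k=N$; every map is $(-1)$-connected. A *weak equivalence* is a map inducing bijections on $\pi_0$ and on all $\pi_k$ at all basepoints. For maps $u\colon X\to Z$ and $v\colon X'\to Z$, $\operatorname{holim}(X\to Z\leftarrow X')$ is the space of triples $(x,\gamma,x')$ with $\gamma$ a path in $Z$ from $u(x)$ to $v(x')$. Let $\mathcal C$ be a category enriched in a convenient category of spaces (for instance compactly generated or $\Delta$-generated spaces; in general, the spaces generated by a family of locally compact test spaces such that binary products of test spaces, and the unit interval, are generated by the family), with mapping spaces $\mathrm{Map}_{\mathcal C}(X,Y)$. Its homotopy category $h\mathcal C$ has the same objects and $\mathrm{Hom}_{h\mathcal C}(X,Y)=\pi_0\mathrm{Map}_{\mathcal C}(X,Y)$; two maps are homotopic if they are joined by a path in the mapping space. For $f\colon A\to B$ in $\mathcal C$, an object $Y$ is *$f$-local* if $f^*\colon\mathrm{Map}_{\mathcal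 C}(B,Y)\to\mathrm{Map}_{\mathcal C}(A,Y)$ is a weak equivalence. A *homotopy pushout* of $B\xleftarrow{f}A\xrightarrow{g}B'$ is an object $P$ with maps $i\colon B\to P$, $j\colon B'\to P$ and a path in $\mathrm{Map}_{\mathcal C}(A,P)$ from $if$ to $jg$ such that, for every object $Y$, the induced map $$\mathrm{Map}_{\mathcal C}(P,Y)\to\operatorname{holim}\bigl(\mathrm{Map}_{\mathcal C}(B,Y)\to\mathrm{Map}_{\mathcal C}(A,Y)\leftarrow\mathrm{Map}_{\mathcal C}(B',Y)\bigr)$$ is a weak equivalence; $\mathcal C$ *has homotopy pushouts* if every such span has one. **(1) Lemma.** Let $f\colon X\to Y$ be a map of spaces and $N\ge 0$. Then $f$ is $N$-connected if and only if $\pi_0(X)\to\pi_0(Y)$ is surjective and the diagonal $X\to\operatorname{holim}(X\to Y\leftarrow X)$, $x\mapsto(x,\mathrm{const}_{f(x)},x)$, is $(N-1)$-connected. **(2) Corollary.** Suppose that $\mathcal C$ has homotopy pushouts and let $f_0\colon A_0\to B$ be a map in $\mathcal C$. Then one can inductively form iterated double mapping cylinders $$f_n\colon A_n=\operatorname{hocolim}(B\xleftarrow{f_{n-1}}A_{n-1}\xrightarrow{f_{n-1}}B)\to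 B\qquad(n\ge1),$$ where $A_n$ is any homotopy pushout and $f_n$ is any map in the homotopy class induced by the identity of $B$ on both copies of $B$ and the constant homotopy at $f_{n-1}$. For every such choice and every object $Y$ of $\mathcal C$, the following are equivalent: (a) $Y$ is $f_0$-local; (b) for all $n\ge0$ the map $f_n^*\colon\mathrm{Hom}_{h\mathcal C}(B,Y)\to\mathrm{Hom}_{h\mathcal C}(A_n,Y)$ is surjective; (c) for all $n\ge0$ and every map $g\colon A_n\to Y$ there is a map $\tilde g\colon B\to Y$ such that $\tilde g f_n$ is homotopic to $g$. -/

import Mathlib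

open CategoryTheory Topology
open scoped unitInterval

universe t s v u w w'

/-! ### Homotopy groups, weak equivalences, connectivity, homotopy pullbacks of spaces -/

section Spaces

variable {X : Type w} {Y : Type w'} [TopologicalSpace X] [TopologicalSpace Y]

/-- The map `π₀(X) → π₀(Y)` induced by a continuous map. -/
def piZeroMap (f : C(X, Y)) : ZerothHomotopy X → ZerothHomotopy Y :=
  Quotient.map f fun _ _ h => h.map f.continuous

/-- The map `π_n(X, x) → π_n(Y, f x)` induced by a continuous map. -/
def piMap (n : ℕ) (f : C(X, Y)) (x : X) :
    HomotopyGroup.Pi n X x → HomotopyGroup.Pi n Y (f x) :=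
  Quotient.map
    (fun p : GenLoop (Fin n) X x =>
      (⟨f.comp p.1, fun y hy => congrArg f (p.2 y hy)⟩ : GenLoop (Fin n) Y (f x)))
    fun _ _ h => ContinuousMap.HomotopicRel.comp_continuousMap h f

/-- A weak homotopy equivalence: bijective on `π₀` and on all homotopy groups at all basepoints. -/
def IsWeakEquiv (f : C(X, Y)) : Prop :=
  Function.Bijective (piZeroMap f) ∧ ∀ (n : ℕ) (x : X), Function.Bijective (piMap n f x)

/-- `f` is `N`-connected: for every basepoint it is bijective on `π_k` for `k < N` and surjective on
`π_k` for `k = N`, and it is surjective on (unpointed) `π₀` if `0 ≤ N`. Every map is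
`(-1)`-connected. -/
def IsConnectedMap (N : ℤ) (f : C(X, Y)) : Prop :=
  (0 ≤ N → Function.Surjective (piZeroMap f)) ∧
    ∀ (k : ℕ) (x : X), ((k : ℤ) < N → Function.Injective (piMap k f x)) ∧
      ((k : ℤ) ≤ N → Function.Surjective (piMap k f x))

/-- The homotopy limit of a cospan `X → Z ← Y` of spaces: triples of a point `x` of `X`, a path in
`Z`, and a point `y` of `Y`, such that the path runs from the image of `x` to that of `y`. -/
def HoPullback {Z : Type*} [TopologicalSpace Z] (f : C(X, Z)) (g : C(Y, Z)) :=
  {p : X × C(I, Z) × Y // p.2.1 0 = f p.1 ∧ p.2.1 1 = g p.2.2}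

instance {Z : Type*} [TopologicalSpace Z] (f : C(X, Z)) (g : C(Y, Z)) :
    TopologicalSpace (HoPullback f g) :=
  inferInstanceAs (TopologicalSpace (Subtype _))

/-- The diagonal `X → holim (X → Y ← X)`. -/
def hoDiagonal (f : C(X, Y)) : C(X, HoPullback f f) where
  toFun x := ⟨(x, ContinuousMap.const I (f x), x), rfl, rfl⟩
  continuous_toFun := by
    refine Continuous.subtype_mk (continuous_id.prodMk (Continuous.prodMk ?_ continuous_id)) _
    exact ContinuousMap.continuous_const'.comp f.continuous

end Spaces

/-! ### Categories enriched in a convenient category of spaces -/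

/-- A family of test spaces whose generated spaces (`IsGeneratedBy T`) form a convenient category
of spaces with internal function objects, containing the unit interval. Taking for `T` all compact
Hausdorff spaces gives the compactly generated spaces, and the spaces `ℝⁿ` give the
delta-generated spaces. -/
class IsConvenient {ι : Type t} (T : ι → Type s) [∀ i, TopologicalSpace (T i)] : Prop where
  locallyCompact (i : ι) : LocallyCompactSpace (T i)
  prod (i j : ι) : IsGeneratedBy T (T i × T j)
  interval : IsGeneratedBy T I

/-- A topology on every set of morphisms of a category; `X ⟶ Y` with it is the mapping space
`Map(X, Y)`. -/
class HomSpaces (C : Type u) [Category.{v} C] where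
  top (X Y : C) : TopologicalSpace (X ⟶ Y)

instance {C : Type u} [Category.{v} C] [HomSpaces C] (X Y : C) : TopologicalSpace (X ⟶ Y) :=
  HomSpaces.top X Y

/-- `C` is enriched in the category of `T`-generated spaces: mapping spaces are `T`-generated and
composition is continuous on the product `Map(X, Y) × Map(Y, Z)` formed in `T`-generated spaces,
whose topology is the one generated by all maps from the test spaces into the usual product. -/
class IsSpaceEnriched {ι : Type t} (T : ι → Type s) [∀ i, TopologicalSpace (T i)]
    (C : Type u) [Category.{v} C] [HomSpaces C] : Prop where
  generated (X Y : C) : IsGeneratedBy T (X ⟶ Y)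
  comp_continuous (X Y Z : C) :
    ContinuousGeneratedBy T fun p : (X ⟶ Y) × (Y ⟶ Z) => p.1 ≫ p.2

/-- The product of a test space with the unit interval is `T`-generated. -/
lemma IsConvenient.prod_interval {ι : Type t} (T : ι → Type s) [∀ i, TopologicalSpace (T i)]
    [IsConvenient T] (i : ι) : IsGeneratedBy T (T i × I) := by
  have := IsConvenient.locallyCompact (T := T) i
  have := IsConvenient.interval (T := T)
  rw [isGeneratedBy_iff]
  set g := (WithGeneratedByTopology.equiv (X := T) (Y := T i × I)).symm with hg
  have key : ∀ {j : ι} (q : C(T j, T i × I)), Continuous (g ∘ q) := fun q =>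
    (IsGeneratedBy.equiv_symm_comp_continuous_iff T _).2 q.continuous
  have h1 : ∀ r : I, Continuous fun a : T i => g (a, r) := fun r =>
    key ⟨fun a => (a, r), by fun_prop⟩
  let G : I → C(T i, WithGeneratedByTopology T (T i × I)) := fun r => ⟨fun a => g (a, r), h1 r⟩
  have hG : Continuous G := by
    rw [IsGeneratedBy.continuous_iff T]
    intro j q
    refine ContinuousMap.continuous_of_continuous_uncurry _ ?_
    have := IsConvenient.prod (T := T) j i
    rw [IsGeneratedBy.continuous_iff T]
    intro k p
    exact key ⟨fun z => ((p z).2, q (p z).1), by fun_prop⟩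
  have h2 := ContinuousMap.continuous_uncurry_of_continuous ⟨G, hG⟩
  exact h2.comp continuous_swap

section Enriched

variable {ι : Type t} (T : ι → Type s) [∀ i, TopologicalSpace (T i)]
  {C : Type u} [Category.{v} C] [HomSpaces C]

lemma IsSpaceEnriched.continuous_comp [IsSpaceEnriched T C] {K : Type*} [TopologicalSpace K]
    [IsGeneratedBy T K] {X Y Z : C} {a : K → (X ⟶ Y)} {b : K → (Y ⟶ Z)}
    (ha : Continuous a) (hb : Continuous b) : Continuous fun k => a k ≫ b k := by
  rw [IsGeneratedBy.continuous_iff T]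
  intro i q
  exact IsSpaceEnriched.comp_continuous X Y Z
    (⟨fun z => (a (q z), b (q z)), by fun_prop⟩ : C(T i, (X ⟶ Y) × (Y ⟶ Z)))

/-- The map `f^* : Map(B, Y) → Map(A, Y)`. -/
def mapPrecomp [IsSpaceEnriched T C] {A B : C} (f : A ⟶ B) (Y : C) : C(B ⟶ Y, A ⟶ Y) where
  toFun g := f ≫ g
  continuous_toFun := by
    have := IsSpaceEnriched.generated (T := T) B Y
    exact IsSpaceEnriched.continuous_comp T continuous_const continuous_id

/-- `Y` is `f`-local. -/
def IsLocalFor [IsSpaceEnriched T C] {A B : C} (f : A ⟶ B) (Y : C) : Prop :=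
  IsWeakEquiv (mapPrecomp T f Y)

/-- The homotopy category `hC`: it has the objects of `C`, and the morphisms from `X` to `Y` are
the elements of `π₀ Map(X, Y)`. -/
structure HoCat {ι : Type t} (T : ι → Type s) (C : Type u) where
  of : C

instance [IsConvenient T] [IsSpaceEnriched T C] : Category.{v} (HoCat T C) where
  Hom X Y := ZerothHomotopy (X.of ⟶ Y.of)
  id X := ZerothHomotopy.mk (𝟙 X.of)
  comp := Quotient.map₂ (fun f g => f ≫ g) fun _ _ ⟨p⟩ _ _ ⟨q⟩ =>
    have := IsConvenient.interval (T := T)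
    ⟨⟨⟨fun r => p r ≫ q r, IsSpaceEnriched.continuous_comp T p.continuous q.continuous⟩,
      by simp, by simp⟩⟩
  id_comp := by rintro _ _ ⟨f⟩; exact congrArg ZerothHomotopy.mk (Category.id_comp f)
  comp_id := by rintro _ _ ⟨f⟩; exact congrArg ZerothHomotopy.mk (Category.comp_id f)
  assoc := by
    rintro _ _ _ _ ⟨f⟩ ⟨g⟩ ⟨h⟩; exact congrArg ZerothHomotopy.mk (Category.assoc f g h)

/-- The canonical functor `C ⥤ hC`. -/
def toHoCat [IsConvenient T] [IsSpaceEnriched T C] : C ⥤ HoCat T C where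
  obj X := ⟨X⟩
  map f := ZerothHomotopy.mk f

/-- A homotopy coherent cocone with vertex `P` under the span `B ← A → B'`, i.e. a square that
commutes up to a specified homotopy. -/
structure HoCocone {A B B' : C} (f : A ⟶ B) (g : A ⟶ B') (P : C) where
  inl : B ⟶ P
  inr : B' ⟶ P
  htpy : Path (f ≫ inl) (g ≫ inr)

/-- The natural comparison map
`Map(P, Y) → holim (Map(B, Y) → Map(A, Y) ← Map(B', Y))` of a cocone. -/
def HoCocone.comparison [IsConvenient T] [IsSpaceEnriched T C] {A B B' P : C} {f : A ⟶ B}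
    {g : A ⟶ B'} (c : HoCocone f g P) (Y : C) :
    C(P ⟶ Y, HoPullback (mapPrecomp T f Y) (mapPrecomp T g Y)) where
  toFun k := ⟨(c.inl ≫ k,
    ⟨fun r => c.htpy r ≫ k, by
      have := IsConvenient.interval (T := T)
      exact IsSpaceEnriched.continuous_comp T c.htpy.continuous continuous_const⟩,
    c.inr ≫ k), by simp [mapPrecomp], by simp [mapPrecomp]⟩
  continuous_toFun := by
    have := IsSpaceEnriched.generated (T := T) P Y
    refine Continuous.subtype_mk ((mapPrecomp T c.inl Y).continuous.prodMk
      (Continuous.prodMk ?_ (mapPrecomp T c.inr Y).continuous)) _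
    rw [IsGeneratedBy.continuous_iff T]
    intro i q
    refine ContinuousMap.continuous_of_continuous_uncurry _ ?_
    have := IsConvenient.prod_interval T i
    exact IsSpaceEnriched.continuous_comp T (c.htpy.continuous.comp continuous_snd)
      (q.continuous.comp continuous_fst)

/-- The cocone exhibits `P` as the homotopy pushout `hocolim (B ← A → B')`. -/
def HoCocone.IsHoPushout [IsConvenient T] [IsSpaceEnriched T C] {A B B' P : C} {f : A ⟶ B}
    {g : A ⟶ B'} (c : HoCocone f g P) : Prop :=
  ∀ Y : C, IsWeakEquiv (c.comparison T Y)

/-- `C` has homotopy pushouts. -/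
def HasHoPushouts [IsConvenient T] (C : Type u) [Category.{v} C] [HomSpaces C]
    [IsSpaceEnriched T C] : Prop :=
  ∀ ⦃A B B' : C⦄ (f : A ⟶ B) (g : A ⟶ B'), ∃ (P : C) (c : HoCocone f g P), c.IsHoPushout T

/-- `f' : A' ⟶ B` is a double mapping cylinder `hocolim (B ← A → B) → B` of `f : A ⟶ B`: its source
is a homotopy pushout, and `f'` is the map out of it induced by the identity of `B` on both sides
and the constant homotopy at `f`. The induced map is determined up to homotopy only, by the path
component of its image under the comparison map. -/
def IsDoubleMappingCylinder [IsConvenient T] [IsSpaceEnriched T C] {A A' B : C} (f : A ⟶ B)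
    (f' : A' ⟶ B) : Prop :=
  ∃ c : HoCocone f f A', c.IsHoPushout T ∧
    Joined (c.comparison T B f') (hoDiagonal (mapPrecomp T f B) (𝟙 B))

/-- The maps `f_n : A_n ⟶ B` are iterated double mapping cylinders of `f₀`. -/
def IsIteratedDoubleMappingCylinder [IsConvenient T] [IsSpaceEnriched T C] {A₀ B : C}
    (f₀ : A₀ ⟶ B) (F : ℕ → Over B) : Prop :=
  F 0 = Over.mk f₀ ∧ ∀ n, IsDoubleMappingCylinder T (F n).hom (F (n + 1)).hom

end Enriched

/-! ### The homotopy pullback: projections and continuous maps into it -/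

/-! A point of holim (X → Y ← X) is a path in Y between two image points, and it lies in the
component of a diagonal point exactly when that path lifts to X up to homotopy
(`exists_joined_hoDiagonal_iff`). Since iterated loops commute with homotopy pullbacks, the same
holds for Ω^k f. Hence surjectivity of the diagonal on π_k at all basepoints amounts to injectivity
of f on π_k together with surjectivity on π_{k+1}. On homotopy groups the diagonal is always
injective, being split by a projection. Passing to the diagonal therefore lowers connectivity by
exactly one and forgets only surjectivity on π₀ (`isConnectedMap_iff_hoDiagonal`).

For the corollary, the universal property of A_{n+1} identifies f_{n+1}^*, up to a weak equivalence
and a homotopy, with the diagonal of f_n^*. Connectivity is invariant under both, so f_0^* is a weak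
equivalence iff every f_n^* is surjective on π₀, which is the lifting condition. Homotopy invariance
is proved without change-of-basepoint maps: homotopic maps factor through the path space, whose two
evaluations are weak equivalences. -/

namespace HoPullback

variable {X Y Z : Type*} [TopologicalSpace X] [TopologicalSpace Y] [TopologicalSpace Z]
  {f : C(X, Z)} {g : C(Y, Z)}

/-- The projection of the homotopy pullback to the source of the first map. -/
def fst (f : C(X, Z)) (g : C(Y, Z)) : C(HoPullback f g, X) :=
  ⟨fun p => p.1.1, continuous_fst.comp continuous_subtype_val⟩

/-- The projection of the homotopy pullback to the source of the second map. -/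
def snd (f : C(X, Z)) (g : C(Y, Z)) : C(HoPullback f g, Y) :=
  ⟨fun p => p.1.2.2, (continuous_snd.comp continuous_snd).comp continuous_subtype_val⟩

/-- The projection of the homotopy pullback to the space of paths. -/
def mid (f : C(X, Z)) (g : C(Y, Z)) : C(HoPullback f g, C(I, Z)) :=
  ⟨fun p => p.1.2.1, (continuous_fst.comp continuous_snd).comp continuous_subtype_val⟩

lemma mid_zero (p : HoPullback f g) : mid f g p 0 = f (fst f g p) := p.2.1

lemma mid_one (p : HoPullback f g) : mid f g p 1 = g (snd f g p) := p.2.2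

/-- The point of the homotopy pullback given by a path. -/
def ofPath {a : X} {b : Y} (γ : Path (f a) (g b)) : HoPullback f g :=
  ⟨(a, γ.toContinuousMap, b), γ.source, γ.target⟩

@[simp] lemma fst_ofPath {a : X} {b : Y} (γ : Path (f a) (g b)) : fst f g (ofPath γ) = a := rfl

@[simp] lemma snd_ofPath {a : X} {b : Y} (γ : Path (f a) (g b)) : snd f g (ofPath γ) = b := rfl

@[simp] lemma mid_ofPath {a : X} {b : Y} (γ : Path (f a) (g b)) (t : I) :
    mid f g (ofPath γ) t = γ t := rfl

@[ext] lemma ext {p q : HoPullback f g} (h₁ : fst f g p = fst f g q) (h₂ : snd f g p = snd f g q)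
    (h : ∀ t, mid f g p t = mid f g q t) : p = q :=
  Subtype.ext (Prod.ext h₁ (Prod.ext (ContinuousMap.ext h) h₂))

lemma continuous_of {K : Type*} [TopologicalSpace K] {F : K → HoPullback f g}
    (h₁ : Continuous fun k => fst f g (F k)) (h₂ : Continuous fun k => snd f g (F k))
    (h : Continuous fun q : K × I => mid f g (F q.1) q.2) : Continuous F :=
  Continuous.subtype_mk
    (h₁.prodMk ((ContinuousMap.continuous_of_continuous_uncurry _ h).prodMk h₂)) _

@[simp] lemma fst_hoDiagonal (f : C(X, Z)) (x : X) : fst f f (hoDiagonal f x) = x := rfl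

@[simp] lemma snd_hoDiagonal (f : C(X, Z)) (x : X) : snd f f (hoDiagonal f x) = x := rfl

@[simp] lemma mid_hoDiagonal (f : C(X, Z)) (x : X) (t : I) :
    mid f f (hoDiagonal f x) t = f x := rfl

end HoPullback

/-! ### Lifting paths up to homotopy, and path components of the homotopy pullback -/

section PathLifting

variable {X : Type*} {Y : Type*} [TopologicalSpace X] [TopologicalSpace Y]

/-- A path between points in the image of `f` lifts along `f` up to homotopy relative to its
endpoints. -/
def LiftsUpToHomotopy (f : C(X, Y)) {a b : X} (γ : Path (f a) (f b)) : Prop :=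
  ∃ K : Path a b, (K.map f.continuous).Homotopic γ

/-- A square in `Y` whose last side is constant, read as a homotopy between two composite paths. -/
lemma homotopic_of_square {y₀ y₁ z : Y} (S : C(I × I, Y)) (γ : Path y₀ y₁) (α : Path y₀ z)
    (β : Path y₁ z) (hγ : ∀ t, S (0, t) = γ t) (hα : ∀ s, S (s, 0) = α s)
    (hβ : ∀ s, S (s, 1) = β s) (hc : ∀ t, S (1, t) = z) :
    (α.trans β.symm).Homotopic γ := by
  let bot : Path ((0 : I), (0 : I)) (0, 1) := ⟨⟨fun t => (0, t), by fun_prop⟩, rfl, rfl⟩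
  let l : Path ((0 : I), (0 : I)) (1, 0) := ⟨⟨fun t => (t, 0), by fun_prop⟩, rfl, rfl⟩
  let m : Path ((1 : I), (0 : I)) (1, 1) := ⟨⟨fun t => (1, t), by fun_prop⟩, rfl, rfl⟩
  let r : Path ((0 : I), (1 : I)) (1, 1) := ⟨⟨fun t => (t, 1), by fun_prop⟩, rfl, rfl⟩
  have : ContractibleSpace I := (convex_Icc (0 : ℝ) 1).contractibleSpace ⟨0, by simp⟩
  -- Two paths with the same ends in the contractible square are homotopic; `S` pushes this homotopy
  -- to `Y`.
  have h : (l.trans (m.trans r.symm)).Homotopic bot := SimplyConnectedSpace.paths_homotopic _ _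
  have h0 : y₀ = S (0, 0) := by rw [hγ, γ.source]
  have h1 : y₁ = S (0, 1) := by rw [hγ, γ.target]
  have hz : z = S (1, 0) := (hc 0).symm
  have hz' : z = S (1, 1) := (hc 1).symm
  have h' := (h.map S).pathCast h0 h1
  have e1 : (bot.map S.continuous).cast h0 h1 = γ := by ext t; exact hγ t
  have e2 : ((l.trans (m.trans r.symm)).map S.continuous).cast h0 h1
      = α.trans ((Path.refl z).trans β.symm) := by
    have el : (l.map S.continuous).cast h0 hz = α := by ext t; exact hα t
    have em : (m.map S.continuous).cast hz hz' = Path.refl z := by ext t; exact hc t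
    have er : (r.map S.continuous).cast h1 hz' = β := by ext t; exact hβ t
    rw [← el, ← em, ← er]
    simp only [Path.map_trans]
    ext t
    simp [Path.trans_apply]
  rw [e1, e2] at h'
  refine .trans (.hcomp (.refl _) ?_) h'
  exact ⟨(Path.Homotopy.reflTrans _).symm⟩

/-- A point of the homotopy pullback of `f` along itself lies in the path component of a diagonal
point exactly if its path lifts. -/
lemma exists_joined_hoDiagonal_iff (f : C(X, Y)) {a b : X} (γ : Path (f a) (f b)) :
    (∃ c, Joined (hoDiagonal f c) (HoPullback.ofPath γ)) ↔ LiftsUpToHomotopy f γ := by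
  constructor
  · rintro ⟨c, h⟩
    obtain ⟨p⟩ := h.symm
    have cp := p.continuous
    -- The two ends of the moving path trace `α` and `β` in `X`, and the moving path itself sweeps
    -- out a square in `Y` that contracts `γ` onto their images.
    let α : Path a c := ⟨⟨fun s => HoPullback.fst f f (p s), by fun_prop⟩, by simp, by simp⟩
    let β : Path b c := ⟨⟨fun s => HoPullback.snd f f (p s), by fun_prop⟩, by simp, by simp⟩
    refine ⟨α.trans β.symm, ?_⟩
    rw [Path.map_trans, ← Path.map_symm]
    refine homotopic_of_square ⟨fun q => HoPullback.mid f f (p q.1) q.2, by fun_prop⟩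
      γ _ _ ?_ ?_ ?_ ?_
    · intro t; simp
    · intro s; exact HoPullback.mid_zero (p s)
    · intro s; exact HoPullback.mid_one (p s)
    · intro t; simp
  · rintro ⟨K, ⟨H⟩⟩
    -- At time `s` the path is the image of `K` restricted to [0, s], so only the second endpoint
    -- moves, from `a` to `b`.
    have h₁ : Joined (hoDiagonal f a) (HoPullback.ofPath (K.map f.continuous)) := by
      refine ⟨⟨⟨fun s => ⟨(a, ⟨fun t => f (K (s * t)), by fun_prop⟩, K s), by simp, by simp⟩, ?_⟩,
        ?_, ?_⟩⟩
      · exact HoPullback.continuous_of continuous_const K.continuous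
          (f.continuous.comp (K.continuous.comp (by fun_prop)))
      · ext t
        · rfl
        · exact K.source
        · exact (congrArg (fun s => f (K s)) (zero_mul t)).trans (congrArg f K.source)
      · ext t
        · rfl
        · exact K.target
        · exact congrArg (fun s => f (K s)) (one_mul t)
    have h₂ : Joined (HoPullback.ofPath (K.map f.continuous)) (HoPullback.ofPath γ) :=
      ⟨⟨⟨fun s => HoPullback.ofPath (H.eval s), HoPullback.continuous_of continuous_const
        continuous_const H.continuous⟩, by simp, by simp⟩⟩
    exact ⟨a, h₁.trans h₂⟩

/-- Conjugating a lift by `K₀` and `K₁` undoes the change of endpoints. This reduces lifting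
arbitrary paths to lifting loops at a basepoint. -/
lemma LiftsUpToHomotopy.of_trans {f : C(X, Y)} {a b a' b' : X} {γ : Path (f a) (f b)}
    (K₀ : Path a' a) (K₁ : Path b b')
    (h : LiftsUpToHomotopy f
      ((K₀.map f.continuous).trans (γ.trans (K₁.map f.continuous)))) :
    LiftsUpToHomotopy f γ := by
  obtain ⟨L, hL⟩ := h
  refine ⟨K₀.symm.trans (L.trans K₁.symm), ?_⟩
  rw [← Path.Homotopic.Quotient.eq] at hL ⊢
  simp only [Path.map_trans, ← Path.map_symm, Path.Homotopic.Quotient.mk_trans, hL,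
    Path.Homotopic.Quotient.mk_symm]
  simp [Path.Homotopic.Quotient.trans_assoc,
    ← Path.Homotopic.Quotient.trans_assoc (Path.Homotopic.Quotient.symm _)]

/-- Every path between image points lifts up to homotopy: the induced functor of fundamental
groupoids is full. -/
def LiftsPaths (f : C(X, Y)) : Prop :=
  ∀ ⦃a b : X⦄ (γ : Path (f a) (f b)), LiftsUpToHomotopy f γ

lemma surjective_piZeroMap_iff (f : C(X, Y)) :
    Function.Surjective (piZeroMap f) ↔ ∀ y, ∃ x, Joined (f x) y := by
  constructor
  · intro h y
    obtain ⟨⟨x⟩, hx⟩ := h (ZerothHomotopy.mk y)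
    exact ⟨x, Quotient.exact hx⟩
  · rintro h ⟨y⟩
    obtain ⟨x, hx⟩ := h y
    exact ⟨ZerothHomotopy.mk x, Quotient.sound hx⟩

lemma injective_piZeroMap_iff (f : C(X, Y)) :
    Function.Injective (piZeroMap f) ↔ ∀ x x', Joined (f x) (f x') → Joined x x' := by
  constructor
  · intro h x x' hx
    exact Quotient.exact (@h (ZerothHomotopy.mk x) (ZerothHomotopy.mk x') (Quotient.sound hx))
  · rintro h ⟨x⟩ ⟨x'⟩ hx
    exact Quotient.sound (h x x' (Quotient.exact hx))

lemma surjective_piZeroMap_hoDiagonal_iff (f : C(X, Y)) :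
    Function.Surjective (piZeroMap (hoDiagonal f)) ↔ LiftsPaths f := by
  rw [surjective_piZeroMap_iff]
  constructor
  · intro h a b γ
    exact (exists_joined_hoDiagonal_iff f γ).1 (h _)
  · rintro h ⟨⟨a, γ, b⟩, h0, h1⟩
    exact (exists_joined_hoDiagonal_iff f ⟨γ, h0, h1⟩).2 (h _)

end PathLifting

/-! ### Homotopy groups as path components of spaces of generalized loops -/

section GenLoops

open scoped Topology.Homotopy

variable {X Y Z : Type*} [TopologicalSpace X] [TopologicalSpace Y] [TopologicalSpace Z]
  {N : Type*}

lemma GenLoop.continuous_of_uncurry {K : Type*} [TopologicalSpace K] {x : X} {F : K → Ω^ N X x}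
    (h : Continuous fun q : K × (N → I) => F q.1 q.2) : Continuous F :=
  Continuous.subtype_mk (ContinuousMap.continuous_of_continuous_uncurry _ h) _

/-- By currying, π_k becomes π₀ of a loop space, so the π₀ results above apply in every degree. -/
lemma GenLoop.joined_iff_homotopic {x : X} (p q : Ω^ N X x) :
    Joined p q ↔ GenLoop.Homotopic p q := by
  constructor
  · rintro ⟨P⟩
    exact ⟨⟨⟨⟨fun z => P z.1 z.2, by fun_prop⟩, fun y => by simp, fun y => by simp⟩,
      fun t y hy => (GenLoop.boundary (P t) y hy).trans (GenLoop.boundary p y hy).symm⟩⟩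
  · rintro ⟨H⟩
    exact ⟨⟨⟨fun t => ⟨⟨fun y => H (t, y), by fun_prop⟩, fun y hy =>
      (H.eq_fst t hy).trans (GenLoop.boundary p y hy)⟩,
      GenLoop.continuous_of_uncurry H.continuous⟩,
      by ext y; exact H.apply_zero y, by ext y; exact H.apply_one y⟩⟩

/-- The map of spaces of generalized loops induced by a continuous map. -/
def GenLoop.map (N : Type*) (f : C(X, Y)) (x : X) : C(Ω^ N X x, Ω^ N Y (f x)) where
  toFun p := ⟨f.comp p.1, fun y hy => congrArg f (p.2 y hy)⟩
  continuous_toFun := GenLoop.continuous_of_uncurry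
    (f.continuous.comp (continuous_eval (F := Ω^ N X x)))

lemma surjective_piMap_iff (k : ℕ) (f : C(X, Y)) (x : X) :
    Function.Surjective (piMap k f x) ↔
      Function.Surjective (piZeroMap (GenLoop.map (Fin k) f x)) := by
  simp only [surjective_piZeroMap_iff, GenLoop.joined_iff_homotopic]
  constructor
  · intro h q
    obtain ⟨⟨p⟩, hp⟩ := h (Quotient.mk _ q)
    exact ⟨p, Quotient.exact hp⟩
  · rintro h ⟨q⟩
    obtain ⟨p, hp⟩ := h q
    exact ⟨Quotient.mk _ p, Quotient.sound hp⟩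

lemma injective_piMap_iff (k : ℕ) (f : C(X, Y)) (x : X) :
    Function.Injective (piMap k f x) ↔
      Function.Injective (piZeroMap (GenLoop.map (Fin k) f x)) := by
  simp only [injective_piZeroMap_iff, GenLoop.joined_iff_homotopic]
  constructor
  · intro h p q hpq
    exact Quotient.exact (@h (Quotient.mk _ p) (Quotient.mk _ q) (Quotient.sound hpq))
  · rintro h ⟨p⟩ ⟨q⟩ hpq
    exact Quotient.sound (h p q (Quotient.exact hpq))

/-- Generalized loops in a homotopy pullback, as points of the homotopy pullback of spaces of
generalized loops. -/
def GenLoop.toHoPullback (N : Type*) (f : C(X, Y)) (x : X) :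
    C(Ω^ N (HoPullback f f) (hoDiagonal f x),
      HoPullback (GenLoop.map N f x) (GenLoop.map N f x)) where
  toFun p := HoPullback.ofPath (a := GenLoop.map N (HoPullback.fst f f) _ p)
    (b := GenLoop.map N (HoPullback.snd f f) _ p)
    ⟨⟨fun t => ⟨⟨fun y => HoPullback.mid f f (p y) t, by fun_prop⟩, fun y hy =>
      congrArg (fun z => HoPullback.mid f f z t) (GenLoop.boundary p y hy)⟩,
      GenLoop.continuous_of_uncurry (show Continuous fun q : I × (N → I) =>
        HoPullback.mid f f (p q.2) q.1 by fun_prop)⟩,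
      by ext y; exact HoPullback.mid_zero (p y), by ext y; exact HoPullback.mid_one (p y)⟩
  continuous_toFun := by
    refine HoPullback.continuous_of (GenLoop.map N (HoPullback.fst f f) _).continuous
      (GenLoop.map N (HoPullback.snd f f) (hoDiagonal f x)).continuous
      (GenLoop.continuous_of_uncurry ?_)
    have h : Continuous fun q : ((Ω^ N (HoPullback f f) (hoDiagonal f x)) × I) × (N → I) =>
      HoPullback.mid f f (q.1.1 q.2) q.1.2 := by fun_prop
    exact h

/-- The inverse of `GenLoop.toHoPullback`. -/
def GenLoop.ofHoPullback (N : Type*) (f : C(X, Y)) (x : X) :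
    C(HoPullback (GenLoop.map N f x) (GenLoop.map N f x),
      Ω^ N (HoPullback f f) (hoDiagonal f x)) where
  toFun p := ⟨⟨fun y => HoPullback.ofPath (f := f) (g := f)
      (a := HoPullback.fst _ _ p y) (b := HoPullback.snd _ _ p y)
      ⟨⟨fun t => HoPullback.mid _ _ p t y, by fun_prop⟩,
        congrArg (fun q : Ω^ N Y (f x) => q y) (HoPullback.mid_zero p),
        congrArg (fun q : Ω^ N Y (f x) => q y) (HoPullback.mid_one p)⟩,
      HoPullback.continuous_of (map_continuous (HoPullback.fst _ _ p))
        (map_continuous (HoPullback.snd _ _ p)) (show Continuous fun q : (N → I) × I =>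
          HoPullback.mid _ _ p q.2 q.1 by fun_prop)⟩, fun y hy => by
      ext t
      · exact GenLoop.boundary _ y hy
      · exact GenLoop.boundary _ y hy
      · exact GenLoop.boundary (HoPullback.mid _ _ p t) y hy⟩
  continuous_toFun := by
    refine GenLoop.continuous_of_uncurry (HoPullback.continuous_of ?_ ?_ ?_)
    · have h : Continuous fun q : (HoPullback (GenLoop.map N f x) (GenLoop.map N f x)) × (N → I) =>
        HoPullback.fst _ _ q.1 q.2 := by fun_prop
      exact h
    · have h : Continuous fun q : (HoPullback (GenLoop.map N f x) (GenLoop.map N f x)) × (N → I) =>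
        HoPullback.snd _ _ q.1 q.2 := by fun_prop
      exact h
    · have h : Continuous fun q :
        ((HoPullback (GenLoop.map N f x) (GenLoop.map N f x)) × (N → I)) × I =>
        HoPullback.mid _ _ q.1.1 q.2 q.1.2 := by fun_prop
      exact h

/-- Interchanging cube and path coordinates identifies loops in the homotopy pullback with the
homotopy pullback of loop spaces, and matches the two diagonals. -/
lemma surjective_piZeroMap_genLoopMap_hoDiagonal_iff (f : C(X, Y)) (x : X) :
    Function.Surjective (piZeroMap (GenLoop.map N (hoDiagonal f) x)) ↔
      LiftsPaths (GenLoop.map N f x) := by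
  rw [← surjective_piZeroMap_hoDiagonal_iff, surjective_piZeroMap_iff, surjective_piZeroMap_iff]
  constructor
  · intro h q
    obtain ⟨p, hp⟩ := h (GenLoop.ofHoPullback N f x q)
    exact ⟨p, hp.map (GenLoop.toHoPullback N f x).continuous⟩
  · intro h q
    obtain ⟨p, hp⟩ := h (GenLoop.toHoPullback N f x q)
    exact ⟨p, hp.map (GenLoop.ofHoPullback N f x).continuous⟩

lemma surjective_piMap_hoDiagonal_iff (k : ℕ) (f : C(X, Y)) (x : X) :
    Function.Surjective (piMap k (hoDiagonal f) x) ↔ LiftsPaths (GenLoop.map (Fin k) f x) := by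
  rw [surjective_piMap_iff, surjective_piZeroMap_genLoopMap_hoDiagonal_iff]

lemma LiftsPaths.injective_piZeroMap {f : C(X, Y)} (h : LiftsPaths f) :
    Function.Injective (piZeroMap f) := by
  rw [injective_piZeroMap_iff]
  rintro a b ⟨γ⟩
  obtain ⟨K, -⟩ := h γ
  exact ⟨K⟩

lemma Path.Homotopic.congr {x y : X} {p p' q q' : Path x y} (h : p.Homotopic q)
    (hp : ∀ t, p' t = p t) (hq : ∀ t, q' t = q t) : p'.Homotopic q' := by
  obtain rfl : p' = p := by ext t; exact hp t
  obtain rfl : q' = q := by ext t; exact hq t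
  exact h

/-- Loops in the space of `k`-dimensional loops represent the elements of `π_{k+1}`. -/
lemma surjective_piMap_succ_iff (k : ℕ) (f : C(X, Y)) (x : X) :
    Function.Surjective (piMap (k + 1) f x) ↔
      ∀ γ : Path (GenLoop.map (Fin k) f x GenLoop.const) (GenLoop.map (Fin k) f x GenLoop.const),
        LiftsUpToHomotopy (GenLoop.map (Fin k) f x) γ := by
  -- Splitting off coordinate 0 leaves cubes indexed by the remaining coordinates; `e` renumbers
  -- these by `Fin k`.
  let e : {j : Fin (k + 1) // j ≠ 0} ≃ Fin k := (finSuccAboveEquiv 0).symm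
  simp only [surjective_piMap_iff, surjective_piZeroMap_iff, GenLoop.joined_iff_homotopic]
  constructor
  · intro h γ
    let γ' : Path (GenLoop.const : Ω^ {j : Fin (k + 1) // j ≠ 0} Y (f x)) GenLoop.const :=
      γ.map (GenLoop.congr (f x) e).symm.continuous
    obtain ⟨p, hp⟩ := h (GenLoop.fromLoop 0 γ')
    have hp' := GenLoop.homotopicTo 0 hp
    rw [GenLoop.to_from] at hp'
    refine ⟨(GenLoop.toLoop 0 p).map (GenLoop.congr x e).continuous,
      (hp'.map (ContinuousMap.mk _ (GenLoop.congr (f x) e).continuous)).congr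
        (fun t => rfl) fun t => ?_⟩
    exact ((GenLoop.congr (f x) e).apply_symm_apply (γ t)).symm
  · intro h q
    obtain ⟨L, hL⟩ := h ((GenLoop.toLoop 0 q).map (GenLoop.congr (f x) e).continuous)
    let L' : Path (GenLoop.const : Ω^ {j : Fin (k + 1) // j ≠ 0} X x) GenLoop.const :=
      L.map (GenLoop.congr x e).symm.continuous
    refine ⟨GenLoop.fromLoop 0 L', GenLoop.homotopicFrom 0 ?_⟩
    refine (hL.map (ContinuousMap.mk _ (GenLoop.congr (f x) e).symm.continuous)).congr
      (fun t => ?_) fun t => ?_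
    · exact congrArg (fun P => GenLoop.map _ f x (P t)) (GenLoop.to_from 0 L')
    · exact ((GenLoop.congr (f x) e).symm_apply_apply (GenLoop.toLoop 0 q t)).symm

end GenLoops

/-! ### Connectivity of a map and of its diagonal -/

section Connectivity

open scoped Topology.Homotopy

variable {X Y Z : Type*} [TopologicalSpace X] [TopologicalSpace Y] [TopologicalSpace Z]

lemma piMap_mul (k : ℕ) (f : C(X, Y)) (x : X) (a b : HomotopyGroup.Pi (k + 1) X x) :
    piMap (k + 1) f x (a * b) = piMap (k + 1) f x a * piMap (k + 1) f x b := by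
  induction a using Quotient.inductionOn with | _ p
  induction b using Quotient.inductionOn with | _ q
  have h₁ := HomotopyGroup.mul_spec (i := (0 : Fin (k + 1))) (p := p) (q := q)
  have h₂ := HomotopyGroup.mul_spec (i := (0 : Fin (k + 1)))
    (p := GenLoop.map _ f x p) (q := GenLoop.map _ f x q)
  refine (congrArg (piMap (k + 1) f x) h₁).trans (Eq.trans ?_ h₂.symm)
  -- Both products are represented by explicit concatenations, defined by cases, and `f` commutes
  -- with the case distinction.
  refine congrArg (Quotient.mk _) ?_
  ext y
  exact apply_ite f _ _ _

/-- The map on homotopy groups in positive degree as a group homomorphism. -/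
noncomputable def piHom (k : ℕ) (f : C(X, Y)) (x : X) :
    HomotopyGroup.Pi (k + 1) X x →* HomotopyGroup.Pi (k + 1) Y (f x) :=
  MonoidHom.mk' (piMap (k + 1) f x) (piMap_mul k f x)

lemma piMap_comp (k : ℕ) (f : C(X, Y)) (g : C(Y, Z)) (x : X) :
    piMap k (g.comp f) x = piMap k g (f x) ∘ piMap k f x := by
  funext a
  induction a using Quotient.inductionOn with | _ p
  rfl

/-- The first projection is a retraction of the diagonal. -/
lemma injective_piMap_hoDiagonal (k : ℕ) (f : C(X, Y)) (x : X) :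
    Function.Injective (piMap k (hoDiagonal f) x) := by
  refine Function.LeftInverse.injective (g := piMap k (HoPullback.fst f f) (hoDiagonal f x)) ?_
  intro a
  induction a using Quotient.inductionOn with | _ p
  rfl

lemma injective_piMap_of_surjective_hoDiagonal {k : ℕ} {f : C(X, Y)} {x : X}
    (h : Function.Surjective (piMap k (hoDiagonal f) x)) : Function.Injective (piMap k f x) := by
  rw [surjective_piMap_hoDiagonal_iff] at h
  rw [injective_piMap_iff]
  exact h.injective_piZeroMap

lemma surjective_piMap_succ_of_surjective_hoDiagonal {k : ℕ} {f : C(X, Y)} {x : X}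
    (h : Function.Surjective (piMap k (hoDiagonal f) x)) :
    Function.Surjective (piMap (k + 1) f x) := by
  rw [surjective_piMap_hoDiagonal_iff] at h
  rw [surjective_piMap_succ_iff]
  exact fun γ => h γ

/-- Surjectivity on π_{k+2} only lifts loops at the constant cube, whereas a class in the homotopy
pullback may have components far from it. The group structure in positive degree removes this
obstacle: it suffices to treat the kernel of the first projection. -/
lemma surjective_piMap_succ_hoDiagonal {k : ℕ} {f : C(X, Y)} {x : X}
    (hi : Function.Injective (piMap (k + 1) f x))
    (hs : Function.Surjective (piMap (k + 2) f x)) :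
    Function.Surjective (piMap (k + 1) (hoDiagonal f) x) := by
  rw [injective_piMap_iff, injective_piZeroMap_iff] at hi
  rw [surjective_piMap_succ_iff] at hs
  let Δ := piHom k (hoDiagonal f) x
  let pr : HomotopyGroup.Pi (k + 1) (HoPullback f f) (hoDiagonal f x) →*
    HomotopyGroup.Pi (k + 1) X x := piHom k (HoPullback.fst f f) (hoDiagonal f x)
  have hpr : ∀ a, pr (Δ a) = a := by
    intro a
    induction a using Quotient.inductionOn with | _ p
    rfl
  -- elements with trivial first component come from the diagonal
  have key : ∀ z, pr z = 1 → ∃ a, Δ a = z := by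
    intro z hz
    induction z using Quotient.inductionOn with | _ q
    let Q := GenLoop.toHoPullback (Fin (k + 1)) f x q
    let a := HoPullback.fst _ _ Q
    let b := HoPullback.snd _ _ Q
    let γ : Path (GenLoop.map (Fin (k + 1)) f x a) (GenLoop.map (Fin (k + 1)) f x b) :=
      ⟨HoPullback.mid _ _ Q, HoPullback.mid_zero Q, HoPullback.mid_one Q⟩
    obtain ⟨K₀⟩ : Joined GenLoop.const a :=
      ((GenLoop.joined_iff_homotopic _ _).2 (Quotient.exact hz)).symm
    -- `γ` joins the images of `a` and `b`, so injectivity on π_{k+1} puts `b` in the component of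
    -- `a`, hence of the constant.
    obtain ⟨K₁⟩ : Joined b GenLoop.const := (hi _ _ ⟨γ⟩).symm.trans (Joined.symm ⟨K₀⟩)
    obtain ⟨c, hc⟩ := (exists_joined_hoDiagonal_iff _ γ).2
      (LiftsUpToHomotopy.of_trans K₀ K₁ (hs _))
    refine ⟨Quotient.mk _ c, Quotient.sound ((GenLoop.joined_iff_homotopic _ _).1 ?_)⟩
    exact hc.map (GenLoop.ofHoPullback (Fin (k + 1)) f x).continuous
  intro z
  -- Dividing by the diagonal class with the same first component lands in the kernel of `pr`.
  obtain ⟨a, ha⟩ := key ((Δ (pr z))⁻¹ * z) (by rw [map_mul, map_inv, hpr, inv_mul_cancel])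
  exact ⟨pr z * a, (map_mul Δ _ _).trans (by rw [ha, mul_inv_cancel_left])⟩

lemma surjective_piMap_zero_iff (f : C(X, Y)) (x : X) :
    Function.Surjective (piMap 0 f x) ↔ Function.Surjective (piZeroMap f) := by
  have h : piZeroMap f ∘ HomotopyGroup.pi0EquivZerothHomotopy (x := x) =
      HomotopyGroup.pi0EquivZerothHomotopy ∘ piMap 0 f x := by
    funext a
    induction a using Quotient.inductionOn with | _ p
    rfl
  rw [← Equiv.comp_surjective, ← h, Equiv.surjective_comp]

lemma injective_piMap_zero_iff (f : C(X, Y)) (x : X) :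
    Function.Injective (piMap 0 f x) ↔ Function.Injective (piZeroMap f) := by
  have h : piZeroMap f ∘ HomotopyGroup.pi0EquivZerothHomotopy (x := x) =
      HomotopyGroup.pi0EquivZerothHomotopy ∘ piMap 0 f x := by
    funext a
    induction a using Quotient.inductionOn with | _ p
    rfl
  rw [← Equiv.comp_injective, ← h, Equiv.injective_comp]

lemma injective_piZeroMap_of_forall (f : C(X, Y))
    (h : ∀ x, Function.Injective (piMap 0 f x)) : Function.Injective (piZeroMap f) := by
  rintro ⟨a⟩ b hab
  exact (injective_piMap_zero_iff f a).1 (h a) hab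

/-- In degree 0 no group structure is available, but π₁-surjectivity holds at every basepoint:
moving `b` to `a` turns the path into a loop at `f a`. -/
lemma surjective_piZeroMap_hoDiagonal {f : C(X, Y)} (hi : Function.Injective (piZeroMap f))
    (hs : ∀ x, Function.Surjective (piMap 1 f x)) :
    Function.Surjective (piZeroMap (hoDiagonal f)) := by
  rw [injective_piZeroMap_iff] at hi
  rw [surjective_piZeroMap_hoDiagonal_iff]
  intro a b γ
  obtain ⟨K⟩ : Joined b a := (hi _ _ ⟨γ⟩).symm
  refine LiftsUpToHomotopy.of_trans (.refl a) K ?_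
  generalize (Path.map (.refl a) f.continuous).trans (γ.trans (K.map f.continuous)) = δ
  -- Zero-dimensional generalized loops are just points, so the case k = 0 lifts loops in the target
  -- of `f` itself.
  obtain ⟨L, hL⟩ := (surjective_piMap_succ_iff 0 f a).1 (hs a)
    (δ.map (genLoopHomeoOfIsEmpty (Fin 0) (f a)).symm.continuous)
  exact ⟨L.map (genLoopHomeoOfIsEmpty (Fin 0) a).continuous,
    (hL.map (ContinuousMap.mk _ (genLoopHomeoOfIsEmpty (Fin 0) (f a)).continuous)).congr
      (fun _ => rfl) fun _ => rfl⟩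

theorem isConnectedMap_iff_hoDiagonal (f : C(X, Y)) (N : ℕ) :
    IsConnectedMap N f ↔
      Function.Surjective (piZeroMap f) ∧ IsConnectedMap ((N : ℤ) - 1) (hoDiagonal f) := by
  constructor
  · rintro ⟨h₀, h⟩
    -- The existence of such a `k` forces N ≥ 1, which supplies injectivity on π₀ and surjectivity
    -- on π₁.
    have hs : ∀ k : ℕ, (k : ℤ) ≤ N - 1 →
        Function.Surjective (piZeroMap (hoDiagonal f)) ∧
        ∀ x, Function.Surjective (piMap k (hoDiagonal f) x) := by
      intro k hk
      have hz : Function.Surjective (piZeroMap (hoDiagonal f)) :=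
        surjective_piZeroMap_hoDiagonal
          (injective_piZeroMap_of_forall f fun x => (h 0 x).1 (by omega))
          fun x => (h 1 x).2 (by omega)
      refine ⟨hz, fun x => ?_⟩
      cases k with
      | zero => exact (surjective_piMap_zero_iff _ x).2 hz
      | succ k =>
        exact surjective_piMap_succ_hoDiagonal ((h (k + 1) x).1 (by omega))
          ((h (k + 2) x).2 (by push_cast at hk ⊢; omega))
    exact ⟨h₀ (by omega), fun hN => (hs 0 (by simpa using hN)).1, fun k x =>
      ⟨fun _ => injective_piMap_hoDiagonal k f x, fun hk => (hs k hk).2 x⟩⟩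
  · rintro ⟨h₀, -, h⟩
    refine ⟨fun _ => h₀, fun k x => ⟨fun hk => ?_, fun hk => ?_⟩⟩
    · exact injective_piMap_of_surjective_hoDiagonal ((h k x).2 (by omega))
    · cases k with
      | zero => exact (surjective_piMap_zero_iff f x).2 h₀
      | succ k =>
        exact surjective_piMap_succ_of_surjective_hoDiagonal
          ((h k x).2 (by push_cast at hk; omega))

end Connectivity

/-! ### Homotopic maps have the same connectivity -/

section Homotopy

open scoped Topology.Homotopy

/-! ### Radial expansion of the cube with a boundary collar -/

namespace CubeCollar

variable {k : ℕ}

/-- Expansion of the cube about its centre by the factor `1 + t`, cut off at the boundary. -/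
noncomputable def expand (t : I) (y : Fin k → I) : Fin k → I :=
  fun i => Set.projIcc 0 1 zero_le_one (((y i : ℝ) - 1 / 2) * (1 + t) + 1 / 2)

/-- The excess of the expanded point over the boundary of the cube; negative in the interior. -/
noncomputable def excess (t : I) (y : Fin k → I) : ℝ :=
  2 * ‖fun i => (y i : ℝ) - 1 / 2‖ * (1 + t) - 1

/-- The positive part of `excess`. -/
noncomputable def time (t : I) (y : Fin k → I) : I :=
  Set.projIcc 0 1 zero_le_one (excess t y)

/-- Linear interpolation in the unit interval. -/
noncomputable def lerp (s a b : I) : I :=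
  Set.projIcc 0 1 zero_le_one ((1 - s) * a + s * b : ℝ)

@[fun_prop] lemma continuous_expand {K : Type*} [TopologicalSpace K] {t : K → I}
    {y : K → Fin k → I} (ht : Continuous t) (hy : Continuous y) :
    Continuous fun q => expand (t q) (y q) := by
  unfold expand; fun_prop

@[fun_prop] lemma continuous_excess {K : Type*} [TopologicalSpace K] {t : K → I}
    {y : K → Fin k → I} (ht : Continuous t) (hy : Continuous y) :
    Continuous fun q => excess (t q) (y q) := by
  unfold excess; fun_prop

@[fun_prop] lemma continuous_time {K : Type*} [TopologicalSpace K] {t : K → I}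
    {y : K → Fin k → I} (ht : Continuous t) (hy : Continuous y) :
    Continuous fun q => time (t q) (y q) := by
  unfold time; fun_prop

@[fun_prop] lemma continuous_lerp {K : Type*} [TopologicalSpace K] {s a b : K → I}
    (hs : Continuous s) (ha : Continuous a) (hb : Continuous b) :
    Continuous fun q => lerp (s q) (a q) (b q) := by
  unfold lerp; fun_prop

@[simp] lemma lerp_zero (a b : I) : lerp 0 a b = a := by simp [lerp]

@[simp] lemma lerp_one (a b : I) : lerp 1 a b = b := by simp [lerp]

@[simp] lemma lerp_self (s a : I) : lerp s a a = a := by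
  simp only [lerp, ← add_mul, sub_add_cancel, one_mul, Set.projIcc_val]

lemma abs_sub_half_le (a : I) : |(a : ℝ) - 1 / 2| ≤ 1 / 2 := by
  rw [abs_le]; constructor <;> linarith [a.2.1, a.2.2]

lemma norm_le (y : Fin k → I) : ‖fun i => (y i : ℝ) - 1 / 2‖ ≤ 1 / 2 :=
  (pi_norm_le_iff_of_nonneg (by norm_num)).2 fun i => abs_sub_half_le (y i)

lemma expand_zero (y : Fin k → I) : expand 0 y = y := by
  funext i; simp [expand]

lemma excess_zero_nonpos (y : Fin k → I) : excess 0 y ≤ 0 := by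
  have := norm_le y
  simp only [excess, Set.Icc.coe_zero]
  linarith

lemma expand_apply_of_eq {t : I} {y : Fin k → I} {i : Fin k} (h : y i = 0 ∨ y i = 1) :
    expand t y i = y i := by
  have ht := t.2.1
  rcases h with h | h
  · simp only [expand, h, Set.Icc.coe_zero]
    exact Set.projIcc_of_le_left _ (by linarith)
  · simp only [expand, h, Set.Icc.coe_one]
    exact Set.projIcc_of_right_le _ (by linarith)

/-- Boundary points have sup-distance exactly 1/2 from the centre, so the excess is (1 + t) - 1. -/
lemma excess_of_mem_boundary (t : I) {y : Fin k → I} (hy : y ∈ Cube.boundary (Fin k)) :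
    excess t y = t := by
  obtain ⟨i, hi⟩ := hy
  have h₁ : 1 / 2 ≤ ‖fun i => (y i : ℝ) - 1 / 2‖ := by
    refine le_trans ?_ (norm_le_pi_norm (fun i => (y i : ℝ) - 1 / 2) i)
    rcases hi with h | h <;> simp only [h, Set.Icc.coe_zero, Set.Icc.coe_one] <;> norm_num
  rw [excess, le_antisymm (norm_le y) h₁]
  ring

lemma time_of_mem_boundary (t : I) {y : Fin k → I} (hy : y ∈ Cube.boundary (Fin k)) :
    time t y = t := by
  rw [time, excess_of_mem_boundary t hy, Set.projIcc_val]

lemma time_of_nonpos {t : I} {y : Fin k → I} (h : excess t y ≤ 0) : time t y = 0 :=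
  Set.projIcc_of_le_left _ h

/-- If no coordinate were cut off, every coordinate would stay at distance less than 1/2 from the
centre after expansion, making the excess negative. -/
lemma expand_mem_boundary {t : I} {y : Fin k → I} (h : 0 ≤ excess t y) :
    expand t y ∈ Cube.boundary (Fin k) := by
  by_contra hn
  have ht := t.2.1
  have hlt : ∀ i, ‖(y i : ℝ) - 1 / 2‖ < 1 / (2 * (1 + t)) := by
    intro i
    rw [lt_div_iff₀ (by positivity), Real.norm_eq_abs]
    by_contra hle
    refine hn ⟨i, ?_⟩
    rcases le_total 0 ((y i : ℝ) - 1 / 2) with h0 | h0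
    · rw [abs_of_nonneg h0] at hle
      exact Or.inr (Set.projIcc_of_right_le _ (by linarith))
    · rw [abs_of_nonpos h0] at hle
      exact Or.inl (Set.projIcc_of_le_left _ (by linarith))
  have := (pi_norm_lt_iff (by positivity)).2 hlt
  rw [lt_div_iff₀ (by positivity)] at this
  unfold excess at h
  linarith

end CubeCollar

open CubeCollar

/-! ### Evaluations of the path space and homotopy invariance of connectivity -/

variable {X Z W : Type*} [TopologicalSpace X] [TopologicalSpace Z] [TopologicalSpace W]

/-- Evaluation of paths at their start. -/
def evalStart (Z : Type*) [TopologicalSpace Z] : C(C(I, Z), Z) :=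
  ⟨fun γ => γ 0, by fun_prop⟩

/-- A family of maps of cubes to a path space whose adjoint is jointly continuous, as a family of
generalized loops. -/
def GenLoop.ofUncurried {K N : Type*} [TopologicalSpace K] (γ : C(I, Z))
    (F : C((K × (N → I)) × I, Z))
    (hF : ∀ p, ∀ y ∈ Cube.boundary N, ∀ t, F ((p, y), t) = γ t) : C(K, Ω^ N C(I, Z) γ) where
  toFun p := ⟨⟨fun y => F.curry (p, y), by fun_prop⟩,
    fun y hy => ContinuousMap.ext fun t => hF p y hy t⟩
  continuous_toFun := GenLoop.continuous_of_uncurry F.curry.continuous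

/-- Transport of a generalized loop along a path of base points. -/
noncomputable def GenLoop.transport (k : ℕ) (γ : C(I, Z)) :
    C(Ω^ (Fin k) Z (evalStart Z γ), Ω^ (Fin k) C(I, Z) γ) :=
  GenLoop.ofUncurried γ ⟨fun q : ((Ω^ (Fin k) Z (evalStart Z γ)) × (Fin k → I)) × I =>
      -- At time `t` the loop is shrunk into the inner cube, and the surrounding collar runs along
      -- `γ` from γ(0) to γ(t). The formulas agree at excess 0, where the expanded point lies on the
      -- boundary.
      if excess q.2 q.1.2 ≤ 0 then q.1.1 (expand q.2 q.1.2) else γ (time q.2 q.1.2), by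
    refine Continuous.if_le ?_ ?_ ?_ continuous_const ?_
    · exact continuous_fst.fst.eval (by fun_prop)
    · exact γ.continuous.comp (continuous_time continuous_snd continuous_fst.snd)
    · exact continuous_excess continuous_snd continuous_fst.snd
    · intro q hq
      rw [GenLoop.boundary q.1.1 _ (expand_mem_boundary hq.ge), time_of_nonpos hq.le]
      rfl⟩ (by
    intro p y hy t
    show (if excess t y ≤ 0 then p (expand t y) else γ (time t y)) = γ t
    split_ifs with h
    · have ht : t = 0 := by rw [← time_of_mem_boundary t hy, time_of_nonpos h]
      rw [ht, expand_zero]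
      exact GenLoop.boundary p y hy
    · rw [time_of_mem_boundary t hy])

lemma GenLoop.transport_apply {k : ℕ} (γ : C(I, Z)) (p : Ω^ (Fin k) Z (evalStart Z γ))
    (y : Fin k → I) (t : I) : GenLoop.transport k γ p y t =
      if excess t y ≤ 0 then p (expand t y) else γ (time t y) := rfl

lemma GenLoop.map_evalStart_transport {k : ℕ} (γ : C(I, Z))
    (p : Ω^ (Fin k) Z (evalStart Z γ)) :
    GenLoop.map (Fin k) (evalStart Z) γ (GenLoop.transport k γ p) = p := by
  ext y
  refine (GenLoop.transport_apply γ p y 0).trans ?_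
  rw [if_pos (excess_zero_nonpos y), expand_zero]

lemma GenLoop.joined_transport {k : ℕ} (γ : C(I, Z)) (p : Ω^ (Fin k) C(I, Z) γ) :
    Joined p (GenLoop.transport k γ (GenLoop.map (Fin k) (evalStart Z) γ p)) := by
  -- The transported loop is `p` precomposed with (y, t) ↦ (`expand t y`, `time t y`); linear
  -- interpolation from the identity keeps boundary points on their faces and their times fixed.
  let F : C((I × (Fin k → I)) × I, Z) := ⟨fun q =>
    p (fun i => lerp q.1.1 (q.1.2 i) (expand q.2 q.1.2 i)) (lerp q.1.1 q.2 (time q.2 q.1.2)), by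
    have h₁ : Continuous fun q : (I × (Fin k → I)) × I =>
        fun i => lerp q.1.1 (q.1.2 i) (expand q.2 q.1.2 i) := by fun_prop
    have h₂ : Continuous fun q : (I × (Fin k → I)) × I => lerp q.1.1 q.2 (time q.2 q.1.2) := by
      fun_prop
    exact (p.1.continuous.comp h₁).eval h₂⟩
  refine ⟨⟨GenLoop.ofUncurried γ F fun s y hy t => ?_, ?_, ?_⟩⟩
  · show p (fun i => lerp s (y i) (expand t y i)) (lerp s t (time t y)) = γ t
    rw [time_of_mem_boundary t hy, lerp_self]
    obtain ⟨i, hi⟩ := hy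
    rw [GenLoop.boundary p _ ⟨i, by rwa [expand_apply_of_eq hi, lerp_self]⟩]
  · ext y t
    show p (fun i => lerp 0 (y i) (expand t y i)) (lerp 0 t (time t y)) = p y t
    simp
  · ext y t
    show p (fun i => lerp 1 (y i) (expand t y i)) (lerp 1 t (time t y)) =
      GenLoop.transport k γ (GenLoop.map (Fin k) (evalStart Z) γ p) y t
    rw [GenLoop.transport_apply]
    simp only [lerp_one]
    split_ifs with h
    · rw [time_of_nonpos h]; rfl
    · rw [GenLoop.boundary p _ (expand_mem_boundary (not_le.1 h).le)]

lemma bijective_piMap_evalStart (k : ℕ) (γ : C(I, Z)) :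
    Function.Bijective (piMap k (evalStart Z) γ) := by
  rw [Function.Bijective, injective_piMap_iff, surjective_piMap_iff, injective_piZeroMap_iff,
    surjective_piZeroMap_iff]
  refine ⟨fun p q h => ?_, fun q => ⟨GenLoop.transport k γ q, ?_⟩⟩
  · exact (GenLoop.joined_transport γ p).trans
      ((h.map (GenLoop.transport k γ).continuous).trans (GenLoop.joined_transport γ q).symm)
  · rw [GenLoop.map_evalStart_transport]

lemma bijective_piMap_homeomorph (k : ℕ) (e : X ≃ₜ Z) (x : X) :
    Function.Bijective (piMap k (e : C(X, Z)) x) := by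
  -- The basepoint `e.symm (e x)` is `x` only propositionally, so the inverse on loops is built by
  -- hand.
  let r : C(Ω^ (Fin k) Z (e x), Ω^ (Fin k) X x) :=
    ⟨fun q => ⟨(e.symm : C(Z, X)).comp q.1, fun y hy =>
      (congrArg e.symm (q.2 y hy)).trans (e.symm_apply_apply x)⟩,
      GenLoop.continuous_of_uncurry (e.symm.continuous.comp (continuous_eval (F := Ω^ _ Z (e x))))⟩
  have h₁ : ∀ p, r (GenLoop.map (Fin k) (e : C(X, Z)) x p) = p := fun p => by
    ext y; exact e.symm_apply_apply _
  have h₂ : ∀ q, GenLoop.map (Fin k) (e : C(X, Z)) x (r q) = q := fun q => by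
    ext y; exact e.apply_symm_apply _
  rw [Function.Bijective, injective_piMap_iff, surjective_piMap_iff, injective_piZeroMap_iff,
    surjective_piZeroMap_iff]
  refine ⟨fun p q h => ?_, fun q => ⟨r q, by rw [h₂]⟩⟩
  rw [← h₁ p, ← h₁ q]
  exact h.map r.continuous

/-- Evaluation of paths at their end. -/
def evalEnd (Z : Type*) [TopologicalSpace Z] : C(C(I, Z), Z) :=
  ⟨fun γ => γ 1, by fun_prop⟩

lemma bijective_piMap_evalEnd (k : ℕ) (γ : C(I, Z)) :
    Function.Bijective (piMap k (evalEnd Z) γ) := by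
  let e : C(I, Z) ≃ₜ C(I, Z) := unitInterval.symmHomeomorph.arrowCongr (Homeomorph.refl Z)
  have h : evalEnd Z = (evalStart Z).comp (e : C(C(I, Z), C(I, Z))) := by
    ext γ; exact congrArg γ unitInterval.symm_zero.symm
  rw [h, piMap_comp]
  exact (bijective_piMap_evalStart k _).comp (bijective_piMap_homeomorph k e γ)

lemma isConnectedMap_comp_iff {c : C(Z, W)} (h₀ : Function.Bijective (piZeroMap c))
    (h : ∀ k z, Function.Bijective (piMap k c z)) (f : C(X, Z)) (N : ℤ) :
    IsConnectedMap N (c.comp f) ↔ IsConnectedMap N f := by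
  have e : piZeroMap (c.comp f) = piZeroMap c ∘ piZeroMap f := by
    funext a
    induction a using Quotient.inductionOn with | _ p
    rfl
  simp only [IsConnectedMap, piMap_comp, e, (h _ _).1.of_comp_iff,
    Function.Surjective.of_comp_iff', h₀, h]

lemma bijective_piZeroMap_of_homotopyInverse {c : C(Z, W)} (d : C(W, Z))
    (h₁ : ∀ z, Joined (d (c z)) z) (h₂ : ∀ w, Joined (c (d w)) w) :
    Function.Bijective (piZeroMap c) := by
  rw [Function.Bijective, injective_piZeroMap_iff, surjective_piZeroMap_iff]
  exact ⟨fun x x' h => (h₁ x).symm.trans ((h.map d.continuous).trans (h₁ x')),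
    fun w => ⟨d w, h₂ w⟩⟩

lemma joined_const_path (γ : C(I, Z)) (t : I) : Joined (ContinuousMap.const I (γ t)) γ := by
  have hc : Continuous fun q : I × I => γ (lerp q.1 t q.2) :=
    by fun_prop
  exact ⟨⟨⟨fun s => ⟨fun r => γ (lerp s t r), by fun_prop⟩,
    ContinuousMap.continuous_of_continuous_uncurry _ hc⟩, by ext r; simp, by ext r; simp⟩⟩

/-- Homotopic maps are equally connected. -/
lemma ContinuousMap.Homotopic.isConnectedMap_iff {f g : C(X, Z)} (h : f.Homotopic g) (N : ℤ) :
    IsConnectedMap N f ↔ IsConnectedMap N g := by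
  obtain ⟨H⟩ := h
  let G : C(X, C(I, Z)) := (H.toContinuousMap.comp ContinuousMap.prodSwap).curry
  have hf : f = (evalStart Z).comp G := by ext x; exact (H.apply_zero x).symm
  have hg : g = (evalEnd Z).comp G := by ext x; exact (H.apply_one x).symm
  rw [hf, hg, isConnectedMap_comp_iff (bijective_piZeroMap_of_homotopyInverse
      (.const' : C(Z, C(I, Z))) (fun γ => joined_const_path γ 0) fun z => .refl z)
      bijective_piMap_evalStart,
    isConnectedMap_comp_iff (bijective_piZeroMap_of_homotopyInverse
      (.const' : C(Z, C(I, Z))) (fun γ => joined_const_path γ 1) fun z => .refl z)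
      bijective_piMap_evalEnd]

end Homotopy

/-! ### Products of generated spaces -/

section Generated

variable {ι : Type t} (T : ι → Type s) [∀ i, TopologicalSpace (T i)]

lemma isGeneratedBy_prod_of_test_prod (K L : Type*) [TopologicalSpace K] [TopologicalSpace L]
    [LocallyCompactSpace K] [IsGeneratedBy T K] [IsGeneratedBy T L]
    (hK : ∀ j, IsGeneratedBy T (T j × K)) : IsGeneratedBy T (K × L) := by
  rw [isGeneratedBy_iff]
  set g := (WithGeneratedByTopology.equiv (X := T) (Y := K × L)).symm
  have key : ∀ {j : ι} (q : C(T j, K × L)), Continuous (g ∘ q) := fun q =>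
    (IsGeneratedBy.equiv_symm_comp_continuous_iff T _).2 q.continuous
  have h₁ : ∀ l : L, Continuous fun a : K => g (a, l) := fun l => by
    rw [IsGeneratedBy.continuous_iff T]
    exact fun j q => key ⟨fun z => (q z, l), by fun_prop⟩
  let G : L → C(K, WithGeneratedByTopology T (K × L)) := fun l => ⟨fun a => g (a, l), h₁ l⟩
  have hG : Continuous G := by
    rw [IsGeneratedBy.continuous_iff T]
    intro j q
    refine ContinuousMap.continuous_of_continuous_uncurry _ ?_
    have := hK j
    rw [IsGeneratedBy.continuous_iff T]
    intro k p
    exact key ⟨fun z => ((p z).2, q (p z).1), by fun_prop⟩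
  have h₂ := ContinuousMap.continuous_uncurry_of_continuous ⟨G, hG⟩
  exact h₂.comp continuous_swap

/-- The product of two generated spaces, one of them locally compact, is generated. -/
lemma IsConvenient.isGeneratedBy_prod [IsConvenient T] (K L : Type*) [TopologicalSpace K]
    [TopologicalSpace L] [LocallyCompactSpace K] [IsGeneratedBy T K] [IsGeneratedBy T L] :
    IsGeneratedBy T (K × L) :=
  isGeneratedBy_prod_of_test_prod T K L fun j =>
    have := IsConvenient.locallyCompact (T := T) j
    isGeneratedBy_prod_of_test_prod T (T j) K fun i => IsConvenient.prod i j

end Generated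

/-! ### Double mapping cylinders and the diagonal -/

section Enriched

variable {ι : Type t} (T : ι → Type s) [∀ i, TopologicalSpace (T i)] [IsConvenient T]
  {C : Type u} [Category.{v} C] [HomSpaces C] [IsSpaceEnriched T C]

/-- A path from the comparison image of `f'` to the diagonal point of the identity induces a
homotopy between the composite of `f'^*` with the comparison map and the diagonal of `f^*`. -/
lemma homotopic_comparison_comp_mapPrecomp {A A' B : C} {f : A ⟶ B} {f' : A' ⟶ B}
    (c : HoCocone f f A')
    (h : Joined (c.comparison T B f') (hoDiagonal (mapPrecomp T f B) (𝟙 B))) (Y : C) :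
    ((c.comparison T Y).comp (mapPrecomp T f' Y)).Homotopic (hoDiagonal (mapPrecomp T f Y)) := by
  obtain ⟨q⟩ := h
  have := IsConvenient.interval (T := T)
  have := IsSpaceEnriched.generated (T := T) B Y
  have hg := IsConvenient.isGeneratedBy_prod T I (B ⟶ Y)
  have hg' : IsGeneratedBy T ((I × (B ⟶ Y)) × I) :=
    have := IsConvenient.isGeneratedBy_prod T I (I × (B ⟶ Y))
    (Homeomorph.prodComm I (I × (B ⟶ Y))).isQuotientMap.isGeneratedBy
  let φ := mapPrecomp T f B
  have hq := q.continuous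
  let H : I × (B ⟶ Y) → HoPullback (mapPrecomp T f Y) (mapPrecomp T f Y) := fun r =>
    HoPullback.ofPath (a := HoPullback.fst φ φ (q r.1) ≫ r.2)
      (b := HoPullback.snd φ φ (q r.1) ≫ r.2)
      ⟨⟨fun t => HoPullback.mid φ φ (q r.1) t ≫ r.2,
        IsSpaceEnriched.continuous_comp T (by fun_prop) continuous_const⟩,
        (congrArg (· ≫ r.2) (HoPullback.mid_zero (q r.1))).trans (Category.assoc _ _ _),
        (congrArg (· ≫ r.2) (HoPullback.mid_one (q r.1))).trans (Category.assoc _ _ _)⟩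
  have hH : Continuous H := HoPullback.continuous_of
    (IsSpaceEnriched.continuous_comp T (by fun_prop) (by fun_prop))
    (IsSpaceEnriched.continuous_comp T (by fun_prop) (by fun_prop))
    (IsSpaceEnriched.continuous_comp T (a := fun r : (I × (B ⟶ Y)) × I =>
      HoPullback.mid φ φ (q r.1.1) r.2) (b := fun r => r.1.2) (by fun_prop) (by fun_prop))
  refine ⟨⟨⟨H, hH⟩, fun g => ?_, fun g => ?_⟩⟩
  · ext t
    · exact (congrArg (fun z => HoPullback.fst φ φ z ≫ g) q.source).trans (Category.assoc _ _ _)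
    · exact (congrArg (fun z => HoPullback.snd φ φ z ≫ g) q.source).trans (Category.assoc _ _ _)
    · exact (congrArg (fun z => HoPullback.mid φ φ z t ≫ g) q.source).trans (Category.assoc _ _ _)
  · ext t
    · exact (congrArg (fun z => HoPullback.fst φ φ z ≫ g) q.target).trans (Category.id_comp g)
    · exact (congrArg (fun z => HoPullback.snd φ φ z ≫ g) q.target).trans (Category.id_comp g)
    · exact (congrArg (fun z => HoPullback.mid φ φ z t ≫ g) q.target).trans
        (congrArg (· ≫ g) (Category.comp_id f))

lemma IsDoubleMappingCylinder.isConnectedMap_hoDiagonal_iff {A A' B : C} {f : A ⟶ B} {f' : A' ⟶ B}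
    (h : IsDoubleMappingCylinder T f f') (Y : C) (N : ℤ) :
    IsConnectedMap N (hoDiagonal (mapPrecomp T f Y)) ↔ IsConnectedMap N (mapPrecomp T f' Y) := by
  obtain ⟨c, hc, hf'⟩ := h
  rw [← (homotopic_comparison_comp_mapPrecomp T c hf' Y).isConnectedMap_iff,
    isConnectedMap_comp_iff (hc Y).1 (hc Y).2]

lemma isWeakEquiv_iff_isConnectedMap {X Y : Type*} [TopologicalSpace X] [TopologicalSpace Y]
    (f : C(X, Y)) : IsWeakEquiv f ↔ ∀ N : ℕ, IsConnectedMap N f := by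
  constructor
  · exact fun h N => ⟨fun _ => h.1.2, fun k x => ⟨fun _ => (h.2 k x).1, fun _ => (h.2 k x).2⟩⟩
  · intro h
    have h' : ∀ k x, Function.Bijective (piMap k f x) := fun k x =>
      ⟨((h (k + 1)).2 k x).1 (by push_cast; omega), ((h k).2 k x).2 le_rfl⟩
    exact ⟨⟨injective_piZeroMap_of_forall f fun x => (h' 0 x).1, (h 0).1 le_rfl⟩, h'⟩

lemma IsConnectedMap.of_neg {X Y : Type*} [TopologicalSpace X] [TopologicalSpace Y] {N : ℤ}
    (hN : N < 0) (f : C(X, Y)) : IsConnectedMap N f :=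
  ⟨fun h => absurd h (not_le.2 hN), fun k _ => ⟨fun h => absurd h (by omega),
    fun h => absurd h (by omega)⟩⟩

/-- Locality is detected by path components of the iterated double mapping cylinders. -/
lemma isLocalFor_iff_surjective_piZeroMap {A₀ B : C} {f₀ : A₀ ⟶ B} {F : ℕ → Over B}
    (hF : IsIteratedDoubleMappingCylinder T f₀ F) (Y : C) :
    IsLocalFor T f₀ Y ↔ ∀ n, Function.Surjective (piZeroMap (mapPrecomp T (F n).hom Y)) := by
  have step : ∀ (N n : ℕ), IsConnectedMap N (mapPrecomp T (F n).hom Y) ↔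
      Function.Surjective (piZeroMap (mapPrecomp T (F n).hom Y)) ∧
        IsConnectedMap ((N : ℤ) - 1) (mapPrecomp T (F (n + 1)).hom Y) := fun N n => by
    rw [isConnectedMap_iff_hoDiagonal, (hF.2 n).isConnectedMap_hoDiagonal_iff T]
  have h₀ : IsLocalFor T f₀ Y ↔ IsWeakEquiv (mapPrecomp T (F 0).hom Y) := by
    rw [hF.1]; rfl
  rw [h₀, isWeakEquiv_iff_isConnectedMap]
  constructor
  · intro h
    have hn : ∀ n, ∀ N : ℕ, IsConnectedMap N (mapPrecomp T (F n).hom Y) := by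
      intro n
      induction n with
      | zero => exact h
      | succ n ih =>
        intro N
        have := ((step (N + 1) n).1 (ih (N + 1))).2
        rwa [Nat.cast_succ, add_sub_cancel_right] at this
    exact fun n => (hn n 0).1 le_rfl
  · intro h N
    have hN : ∀ n, IsConnectedMap N (mapPrecomp T (F n).hom Y) := by
      induction N with
      | zero => exact fun n => (step 0 n).2 ⟨h n, .of_neg (by norm_num) _⟩
      | succ N ih =>
        refine fun n => (step (N + 1) n).2 ⟨h n, ?_⟩
        rw [Nat.cast_succ, add_sub_cancel_right]
        exact ih (n + 1)
    exact hN 0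

lemma exists_isDoubleMappingCylinder (h : HasHoPushouts T C) {A B : C} (f : A ⟶ B) :
    ∃ F' : Over B, IsDoubleMappingCylinder T f F'.hom := by
  obtain ⟨P, c, hc⟩ := h f f
  obtain ⟨f', hf'⟩ := (surjective_piZeroMap_iff _).1 (hc B).1.2
    (hoDiagonal (mapPrecomp T f B) (𝟙 B))
  exact ⟨Over.mk f', c, hc, hf'⟩

lemma exists_isIteratedDoubleMappingCylinder (h : HasHoPushouts T C) {A₀ B : C} (f₀ : A₀ ⟶ B) :
    ∃ F : ℕ → Over B, IsIteratedDoubleMappingCylinder T f₀ F := by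
  choose next hnext using fun G : Over B => exists_isDoubleMappingCylinder T h G.hom
  exact ⟨fun n => n.rec (Over.mk f₀) fun _ G => next G, rfl, fun n => hnext _⟩

end Enriched

theorem mainTheorem4 :
    -- connectivity of a map of spaces in terms of its diagonal
    (∀ (X : Type w) (Y : Type w') [TopologicalSpace X] [TopologicalSpace Y] (f : C(X, Y)) (N : ℕ),
      IsConnectedMap N f ↔
        Function.Surjective (piZeroMap f) ∧ IsConnectedMap ((N : ℤ) - 1) (hoDiagonal f)) ∧
    -- the lifting criterion
    (∀ {ι : Type t} (T : ι → Type s) [∀ i, TopologicalSpace (T i)] [IsConvenient T]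
      (C : Type u) [Category.{v} C] [HomSpaces C] [IsSpaceEnriched T C],
      HasHoPushouts T C → ∀ {A₀ B : C} (f₀ : A₀ ⟶ B),
        (∃ F : ℕ → Over B, IsIteratedDoubleMappingCylinder T f₀ F) ∧
        ∀ F : ℕ → Over B, IsIteratedDoubleMappingCylinder T f₀ F → ∀ Y : C,
          (IsLocalFor T f₀ Y ↔ ∀ n, Function.Surjective
            fun g : (toHoCat T).obj B ⟶ (toHoCat T).obj Y => (toHoCat T).map (F n).hom ≫ g) ∧
          (IsLocalFor T f₀ Y ↔ ∀ (n : ℕ) (g : (F n).left ⟶ Y),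
            ∃ g' : B ⟶ Y, Joined ((F n).hom ≫ g') g)) := by
  refine ⟨fun X Y _ _ f N => isConnectedMap_iff_hoDiagonal f N, ?_⟩
  intro ι T _ _ C _ _ _ hC A₀ B f₀
  refine ⟨exists_isIteratedDoubleMappingCylinder T hC f₀, fun F hF Y => ?_⟩
  have h := isLocalFor_iff_surjective_piZeroMap T hF Y
  refine ⟨h.trans (forall_congr' fun n => ?_), h.trans (forall_congr' fun n => ?_)⟩
  · have e : (fun g : (toHoCat T).obj B ⟶ (toHoCat T).obj Y => (toHoCat T).map (F n).hom ≫ g) =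
        piZeroMap (mapPrecomp T (F n).hom Y) := by
      funext g
      induction g using Quotient.inductionOn with | _ g
      rfl
    rw [e]
    rfl
  · exact surjective_piZeroMap_iff _
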